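/- **Conventions.** All multipoles and graphs are finite and cubic (every vertex has three edge ends); loops and multiple edges are allowed, an edge has two ends, and an end not incident with a vertex is a semiedge. A $(2,2)$-pole has four semiedges, arranged in an input and an output connector of size $2$; a $(2,2;1)$-pole has one additional, residual semiedge. Fix a tetrahedron $T$ in $PG(3,2)$, that is, a basis $p_1,p_2,p_3,p_4$ of $\mathbb F_2^4$ (the corner points), with the ten points $p_i$ and $p_i+p_j$ ($i\ne j$) and the six lines $\{p_i,p_i+p_j,p_j\}$. A $T$-flow on a multipole assigns to each edge a point of $T$ so that the values at each vertex form a line of $T$. A $(2,2)$-pole $X$ has a transition $\{x,y\}\to\{x',y'\}$ if some $T$-flow on $X$ has values $x,y$ on the input semiedges and $x',y'$ on the output semiedges. Let $\mathtt{ls}$ be the set of all line segments $\{p_i,p_j\}$ and $\mathtt{hl}$ the set of all half-lines $\{p_i,p_i+p_j\}$, $i\neq j$. A transition $\{x,y\}\to\{x',y'\}$ is *collinear* if $x+y=x'+y'\ne0$ and each of the pairs $\{x,y\}$, $\{x',y'\}$ is contained in a line of $T$. A *decollineator* is a $(2,2)$-pole with no collinear transition. A *collineator* is a $(2,2)$-pole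 all of whose transitions are of the form $\mathtt{ls}\to\mathtt{ls}$ or $\mathtt{hl}\to\mathtt{hl}$. A *bipartite $(2,2;1)$-pole* is obtained from a bipartite cubic graph by removing a path $uwv$; its input, output and residual semiedges are those formerly incident with $u$, $v$ and $w$, respectively. **Halin snarks.** A cubic Halin graph $H=C\cup S$ consists of a plane tree $S$ all of whose vertices have valency $1$ or $3$, with at least one trivalent vertex, and a circuit $C=(v_0v_1\dots v_{k-1})$ through all leaves of $S$, in the cyclic order in which they occur around $S$. For each $i\in\{0,\dots,k-1\}$ let $D_i$ be a decollineator and $B_i$ a bipartite $(2,2;1)$-pole. The Halin snark $H^\sharp$ is formed, with indices modulo $k$, by joining the output connector of $D_i$ to the input connector of $B_i$ and the output connector of $B_i$ to the input connector of $D_{i+1}$, adding the tree $S-\{v_0,\dots,v_{k-1}\}$, and attaching the residual semiedge of each $B_i$ to the neighbour of $v_i$ in $S$. The Halin $(2,2)$-pole $Y$ is obtained from $H^\sharp$ by deleting one decollineator $D_j$ and keeping the dangling edges; its input connector consists of the input semiedges of $B_j$ and its output connector of the output semiedges of $B_{j-1}$. **Theorem.** Every transition through a Halin $(2,2)$-pole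 is of the form $\mathtt{ls}\to\mathtt{ls}$ or $\mathtt{hl}\to\mathtt{hl}$. Thus every Halin $(2,2)$-pole is a collineator. -/

import Mathlib

/-! ### Points, lines and shapes of a tetrahedron of `PG(3,2)` -/

/-- The vector space `𝔽₂⁴`; the points of `PG(3,2)` are its nonzero vectors. -/
abbrev Vec : Type := Fin 4 → ZMod 2

/-- A tetrahedron of `PG(3,2)`, given by its four corner points in general position,
that is, by a basis of `𝔽₂⁴`. -/
structure Tetrahedron where
  corner : Fin 4 → Vec
  indep : LinearIndependent (ZMod 2) corner

/-- The ten points of the tetrahedron: four corner points and six midpoints. -/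
def Tetrahedron.points (T : Tetrahedron) : Set Vec :=
  {x | (∃ i, x = T.corner i) ∨ ∃ i j, i ≠ j ∧ x = T.corner i + T.corner j}

/-- The six lines of the tetrahedron. -/
def Tetrahedron.lines (T : Tetrahedron) : Set (Set Vec) :=
  {l | ∃ i j, i ≠ j ∧ l = {T.corner i, T.corner i + T.corner j, T.corner j}}

/-- The six merged shapes: line segment, half-line, angle, altitude, axis, double point. -/
inductive Shape where
  | ls | hl | ang | alt | ax | dpt

/-- The set of all unordered pairs of points of `T` having the given shape. -/
def Tetrahedron.pairs (T : Tetrahedron) : Shape → Set (Sym2 Vec)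
  | .ls => {p | ∃ a b, a ≠ b ∧ p = s(T.corner a, T.corner b)}
  | .hl => {p | ∃ a b, a ≠ b ∧ p = s(T.corner a, T.corner a + T.corner b)}
  | .ang => {p | ∃ a b c, a ≠ b ∧ a ≠ c ∧ b ≠ c ∧
      p = s(T.corner a + T.corner b, T.corner a + T.corner c)}
  | .alt => {p | ∃ a b c, a ≠ b ∧ a ≠ c ∧ b ≠ c ∧
      p = s(T.corner a, T.corner b + T.corner c)}
  | .ax => {p | ∃ a b c d, a ≠ b ∧ a ≠ c ∧ a ≠ d ∧ b ≠ c ∧ b ≠ d ∧ c ≠ d ∧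
      p = s(T.corner a + T.corner b, T.corner c + T.corner d)}
  | .dpt => {p | ∃ x ∈ T.points, p = s(x, x)}

/-! ### Cubic multipoles and tetrahedral flows -/

/-- A finite cubic multipole whose semiedges (free ends) are labelled by `S`.

Its edge ends are the three ends `(v, 0), (v, 1), (v, 2)` at each vertex `v` together with the free
ends `s : S`; every edge consists of two distinct ends, exchanged by `mate`. Loops, multiple edges
and edges with two free ends are allowed. -/
structure Multipole (S : Type) where
  V : Type
  fin : Finite V
  mate : V × Fin 3 ⊕ S → V × Fin 3 ⊕ S
  mate_mate : ∀ x, mate (mate x) = x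
  mate_ne : ∀ x, mate x ≠ x

namespace Multipole

/-- The edge ends of a multipole. -/
abbrev Ends {S : Type} (M : Multipole S) : Type := M.V × Fin 3 ⊕ S

/-- `φ` is a `T`-flow on `M`. A function on the edges is given as a function on the edge ends that
takes equal values at the two ends of an edge. Each value is a point of `T`, and the values at each
vertex form a line of `T`. -/
structure IsTFlow {S : Type} (T : Tetrahedron) (M : Multipole S) (φ : M.Ends → Vec) : Prop where
  edge : ∀ x, φ (M.mate x) = φ x
  point : ∀ x, φ x ∈ T.points
  line : ∀ v : M.V, Set.range (fun i : Fin 3 => φ (Sum.inl (v, i))) ∈ T.lines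

end Multipole

/-- A cubic graph (loops and multiple edges allowed): a multipole without semiedges. -/
abbrev CubicGraph : Type 1 := Multipole Empty

/-- Semiedges of a `(2,2)`-pole: two in the input connector, two in the output connector. -/
inductive Label22 where
  | inp (s : Fin 2)
  | out (s : Fin 2)

/-- Semiedges of a `(2,2;1)`-pole: input connector, output connector, residual semiedge. -/
inductive Label221 where
  | inp (s : Fin 2)
  | out (s : Fin 2)
  | res

/-! ### Transitions through `(2,2)`-poles -/

/-- `p → q` is a transition through the `(2,2)`-pole `X`: some `T`-flow on `X` has value pair `p`
on the input connector and value pair `q` on the output connector. -/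
def HasTransition (T : Tetrahedron) (X : Multipole Label22) (p q : Sym2 Vec) : Prop :=
  ∃ φ : X.Ends → Vec, X.IsTFlow T φ ∧
    p = s(φ (.inr (.inp 0)), φ (.inr (.inp 1))) ∧
    q = s(φ (.inr (.out 0)), φ (.inr (.out 1)))

/-- The transition relation on shapes induced by the transitions through `X`. -/
def shapeTransitions (T : Tetrahedron) (X : Multipole Label22) : Set (Shape × Shape) :=
  {st | ∃ p ∈ T.pairs st.1, ∃ q ∈ T.pairs st.2, HasTransition T X p q}

/-- The transition `{x, y} → {x', y'}` is collinear: it is non-vanishing, and each of the two pairs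
lies in a line of `T`. -/
def IsCollinearTransition (T : Tetrahedron) (p q : Sym2 Vec) : Prop :=
  ∃ x y x' y' : Vec, p = s(x, y) ∧ q = s(x', y') ∧ x + y ≠ 0 ∧ x' + y' ≠ 0 ∧
    (∃ l ∈ T.lines, x ∈ l ∧ y ∈ l) ∧ (∃ l ∈ T.lines, x' ∈ l ∧ y' ∈ l)

/-- A decollineator is a `(2,2)`-pole without collinear transitions. -/
def IsDecollineator (T : Tetrahedron) (X : Multipole Label22) : Prop :=
  ∀ p q, HasTransition T X p q → ¬ IsCollinearTransition T p q

/-- A collineator is a `(2,2)`-pole whose transition relation is contained in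
`{ls → ls, hl → hl}`. -/
def IsCollineator (T : Tetrahedron) (X : Multipole Label22) : Prop :=
  shapeTransitions T X ⊆ {(Shape.ls, Shape.ls), (Shape.hl, Shape.hl)}

/-! ### Bipartite `(2,2;1)`-poles -/

/-- A cubic graph is bipartite if its vertices have a proper `2`-colouring. -/
def CubicGraph.IsBipartite (G : CubicGraph) : Prop :=
  ∃ c : G.V → Bool, ∀ v a w b, G.mate (.inl (v, a)) = .inl (w, b) → c v ≠ c w

/-- `B` is (isomorphic to) the `(2,2;1)`-pole obtained from the cubic graph `G` by removing the path
`u w v`: the input semiedges were incident with `u`, the output semiedges with `v`, the residual one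
with `w`. The injection `f` identifies the ends of `B` with the ends of `G` outside the two edges
`uw` and `wv` of the path. -/
def IsPathRemoval (G : CubicGraph) (u w v : G.V) (B : Multipole Label221) : Prop :=
  u ≠ w ∧ w ≠ v ∧ u ≠ v ∧
  ∃ f : B.Ends → G.V × Fin 3, Function.Injective f ∧
    (∀ x, G.mate (.inl (f x)) = .inl (f (B.mate x))) ∧
    (∃ e : B.V ≃ {x : G.V // x ≠ u ∧ x ≠ w ∧ x ≠ v}, ∀ x i, (f (.inl (x, i))).1 = e x) ∧
    (∀ s, (f (.inr (.inp s))).1 = u) ∧ (∀ s, (f (.inr (.out s))).1 = v) ∧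
    (f (.inr .res)).1 = w ∧
    ∃ a b c d : Fin 3, G.mate (.inl (u, a)) = .inl (w, b) ∧ G.mate (.inl (w, c)) = .inl (v, d) ∧
      (u, a) ∉ Set.range f ∧ (w, b) ∉ Set.range f ∧ (w, c) ∉ Set.range f ∧ (v, d) ∉ Set.range f

/-- A bipartite `(2,2;1)`-pole: one of the form `G_{uwv}` for a bipartite cubic graph `G`. -/
def IsBipartitePole (B : Multipole Label221) : Prop :=
  ∃ (G : CubicGraph) (u w v : G.V), G.IsBipartite ∧ IsPathRemoval G u w v B

/-! ### Cubic Halin graphs -/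

/-- A cubic Halin graph `C ∪ S` with perimeter circuit `C = (v₀ v₁ … v_{k-1})`.

The vertices are `W ⊕ Fin k`, with `inr i` standing for `v_i`, a leaf of the inscribed tree `S`, and
`W` for the set of trivalent vertices of `S`. The plane tree `S` is given by a rotation system:
`nb w 0, nb w 1, nb w 2` are the neighbours of `w` in their cyclic order in the plane. That
`C ∪ S` is plane means that `C` visits the leaves in the order in which the walk around `S`
meets them: having come along an edge to a trivalent vertex, this walk leaves it by the next edge in
the cyclic order. Each leaf has a trivalent neighbour `att i`, that is, `S` is not a single edge. -/
structure CubicHalinGraph (k : ℕ) [NeZero k] where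
  W : Type
  fin : Finite W
  tree : SimpleGraph (W ⊕ Fin k)
  isTree : tree.IsTree
  nb : W → Fin 3 → W ⊕ Fin k
  nb_injective : ∀ w, Function.Injective (nb w)
  adj_inner : ∀ w x, tree.Adj (.inl w) x ↔ ∃ a, nb w a = x
  att : Fin k → W
  adj_leaf : ∀ i x, tree.Adj (.inr i) x ↔ x = .inl (att i)
  contour : ∀ i : Fin k, ∃ x : W ⊕ Fin k,
    Relation.ReflTransGen
      (fun d d' : (W ⊕ Fin k) × (W ⊕ Fin k) =>
        ∃ w a, d = (nb w a, .inl w) ∧ d' = (.inl w, nb w (a + 1)))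
      (.inr i, .inl (att i)) (x, .inr (i + 1))

namespace CubicHalinGraph

variable {k : ℕ} [NeZero k] (H : CubicHalinGraph k)

/-- The vertex at an edge end of the tree; the edge end `inr i` lies at the leaf `v_i`. -/
def src : H.W × Fin 3 ⊕ Fin k → H.W ⊕ Fin k
  | .inl (w, _) => .inl w
  | .inr i => .inr i

/-- The other end-vertex of the edge to which an edge end belongs. -/
def tgt : H.W × Fin 3 ⊕ Fin k → H.W ⊕ Fin k
  | .inl (w, a) => H.nb w a
  | .inr i => .inl (H.att i)

theorem adj_src_tgt (x : H.W × Fin 3 ⊕ Fin k) : H.tree.Adj (H.src x) (H.tgt x) := by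
  rcases x with ⟨w, a⟩ | i
  · exact (H.adj_inner _ _).2 ⟨a, rfl⟩
  · exact (H.adj_leaf _ _).2 rfl

theorem exists_end {x y : H.W ⊕ Fin k} (h : H.tree.Adj x y) :
    ∃ z : H.W × Fin 3 ⊕ Fin k, H.src z = x ∧ H.tgt z = y := by
  rcases x with w | i
  · obtain ⟨a, ha⟩ := (H.adj_inner _ _).1 h
    exact ⟨.inl (w, a), rfl, ha⟩
  · exact ⟨.inr i, rfl, ((H.adj_leaf _ _).1 h).symm⟩

theorem end_ext {z z' : H.W × Fin 3 ⊕ Fin k} (h : H.src z = H.src z') (h' : H.tgt z = H.tgt z') :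
    z = z' := by
  rcases z with ⟨w, a⟩ | i <;> rcases z' with ⟨w', a'⟩ | i' <;> simp only [src, tgt] at h h'
  · obtain rfl := Sum.inl.inj h
    rw [H.nb_injective _ h']
  · exact absurd h (by simp)
  · exact absurd h (by simp)
  · rw [Sum.inr.inj h]

/-- The tree `S' = S - {v₀, …, v_{k-1}}`, with the edge of `S` incident with `v_i` retained as a
dangling edge whose semiedge is labelled `i`. -/
noncomputable def treePole : Multipole (Fin k) where
  V := H.W
  fin := H.fin
  mate x := (H.exists_end (H.adj_src_tgt x).symm).choose
  mate_mate x := by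
    have h := (H.exists_end (H.adj_src_tgt x).symm).choose_spec
    have h' := (H.exists_end
      (H.adj_src_tgt (H.exists_end (H.adj_src_tgt x).symm).choose).symm).choose_spec
    exact H.end_ext (h'.1.trans h.2) (h'.2.trans h.1)
  mate_ne x hx := by
    have h := (H.exists_end (H.adj_src_tgt x).symm).choose_spec
    rw [hx] at h
    exact (H.adj_src_tgt x).ne h.1

end CubicHalinGraph

/-! ### Disjoint unions and junctions of multipoles -/

namespace Multipole

/-- Edge ends of a member of a family, viewed in the disjoint union. -/
def sigmaEnd {ι : Type} {S V : ι → Type} (i : ι) :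
    V i × Fin 3 ⊕ S i → (Σ i, V i) × Fin 3 ⊕ (Σ i, S i) :=
  Sum.map (fun q => (⟨i, q.1⟩, q.2)) (fun s => ⟨i, s⟩)

theorem sigmaEnd_injective {ι : Type} {S V : ι → Type} (i : ι) :
    Function.Injective (sigmaEnd (S := S) (V := V) i) := by
  rintro (⟨v, a⟩ | s) (⟨w, b⟩ | t) h <;> simp_all [sigmaEnd]

/-- The mate of an edge end in the disjoint union. -/
def sigmaMate {ι : Type} {S : ι → Type} (M : ∀ i, Multipole (S i)) :
    (Σ i, (M i).V) × Fin 3 ⊕ (Σ i, S i) → (Σ i, (M i).V) × Fin 3 ⊕ (Σ i, S i)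
  | .inl (⟨i, v⟩, a) => sigmaEnd (V := fun i => (M i).V) i ((M i).mate (.inl (v, a)))
  | .inr ⟨i, s⟩ => sigmaEnd (V := fun i => (M i).V) i ((M i).mate (.inr s))

theorem sigmaMate_sigmaEnd {ι : Type} {S : ι → Type} (M : ∀ i, Multipole (S i)) (i : ι)
    (x : (M i).Ends) :
    sigmaMate M (sigmaEnd (V := fun i => (M i).V) i x)
      = sigmaEnd (V := fun i => (M i).V) i ((M i).mate x) := by
  rcases x with ⟨v, a⟩ | s <;> rfl

theorem exists_sigmaEnd {ι : Type} {S : ι → Type} (M : ∀ i, Multipole (S i))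
    (x : (Σ i, (M i).V) × Fin 3 ⊕ (Σ i, S i)) :
    ∃ i, ∃ y : (M i).Ends, x = sigmaEnd (V := fun i => (M i).V) i y := by
  rcases x with ⟨⟨i, v⟩, a⟩ | ⟨i, s⟩
  · exact ⟨i, .inl (v, a), rfl⟩
  · exact ⟨i, .inr s, rfl⟩

/-- The disjoint union of a finite family of multipoles. -/
def sigma {ι : Type} [Finite ι] {S : ι → Type} (M : ∀ i, Multipole (S i)) :
    Multipole (Σ i, S i) where
  V := Σ i, (M i).V
  fin := by
    have := fun i => (M i).fin
    infer_instance
  mate := sigmaMate M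
  mate_mate x := by
    obtain ⟨i, y, rfl⟩ := exists_sigmaEnd M x
    rw [sigmaMate_sigmaEnd, sigmaMate_sigmaEnd, (M i).mate_mate]
  mate_ne x := by
    obtain ⟨i, y, rfl⟩ := exists_sigmaEnd M x
    rw [sigmaMate_sigmaEnd]
    exact fun h => (M i).mate_ne y (sigmaEnd_injective i h)

/-- In a finite set with an involution `m` without fixed points ("edges") and an involution `σ`
("junctions"), chains of edges and junctions pair up the fixed points of `σ`. -/
theorem existsUnique_chain_end {X : Type} [Finite X] (m σ : X → X) (hm : ∀ x, m (m x) = x)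
    (hm' : ∀ x, m x ≠ x) (hσ : ∀ x, σ (σ x) = x) (x : X) (hx : σ x = x) :
    ∃! y, σ y = y ∧ y ≠ x ∧ Relation.EqvGen (fun a b => b = m a ∨ b = σ a) x y := by
  classical
  let p : X → X := fun z => m (σ z)
  have hp : ∀ z, p z = m (σ z) := fun _ => rfl
  have pinj : Function.Injective p := fun a b h => by
    have h1 := congrArg (fun z => σ (m z)) h
    simpa [hp, hm, hσ] using h1
  have succ : ∀ k, p^[k + 1] x = m (σ (p^[k] x)) := fun k => Function.iterate_succ_apply' p k x
  have rev : ∀ k, p^[k] (σ (p^[k] x)) = x := by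
    intro k
    induction k with
    | zero => exact hx
    | succ k ih =>
      rw [Function.iterate_succ_apply, succ]
      simpa [hp, hm, hσ] using ih
  have hex : ∃ n, 0 < n ∧ σ (p^[n] x) = p^[n] x := by
    obtain ⟨n, hn, h⟩ := pinj.mem_periodicPts x
    exact ⟨n, hn, by rw [h.eq, hx]⟩
  obtain ⟨⟨hn, hfix⟩, hmin⟩ : (0 < Nat.find hex ∧ σ (p^[Nat.find hex] x) = p^[Nat.find hex] x) ∧
      ∀ k, k < Nat.find hex → ¬ (0 < k ∧ σ (p^[k] x) = p^[k] x) :=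
    ⟨Nat.find_spec hex, fun _ h => Nat.find_min hex h⟩
  generalize Nat.find hex = n at hn hfix hmin
  refine ⟨p^[n] x, ⟨hfix, ?_, ?_⟩, ?_⟩
  · intro hper
    have sym : ∀ k ≤ n, σ (p^[k] x) = p^[n - k] x := by
      intro k hk
      apply pinj.iterate k
      rw [rev, ← Function.iterate_add_apply, Nat.add_sub_cancel' hk, hper]
    obtain ⟨j, hj | hj⟩ := Nat.even_or_odd' n
    · have h := sym j (by omega)
      rw [show n - j = j by omega] at h
      exact hmin j (by omega) ⟨by omega, h⟩
    · have h := sym j (by omega)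
      rw [show n - j = j + 1 by omega] at h
      exact hm' (p^[j + 1] x) (by rw [← h, ← succ, h])
  · have : ∀ k, Relation.EqvGen (fun a b => b = m a ∨ b = σ a) x (p^[k] x) := by
      intro k
      induction k with
      | zero => exact .refl _
      | succ k ih =>
        rw [succ]
        exact .trans _ _ _ ih (.trans _ _ _ (.rel _ _ (.inr rfl)) (.rel _ _ (.inl rfl)))
    exact this n
  · rintro y ⟨hy, hyx, hxy⟩
    let C : X → Prop := fun z => ∃ k ≤ n, z = p^[k] x ∨ z = σ (p^[k] x)
    have Cm' : ∀ k ≤ n, C (m (p^[k] x)) := by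
      rintro (_ | k) hk
      · exact ⟨1, hn, .inl (by rw [succ, Function.iterate_zero, id, hx])⟩
      · exact ⟨k, by omega, .inr (by rw [succ, hm])⟩
    have Cm : ∀ z, C z → C (m z) := by
      rintro z ⟨k, hk, rfl | rfl⟩
      · exact Cm' k hk
      · rcases hk.lt_or_eq with h | rfl
        · exact ⟨k + 1, h, .inl (succ k).symm⟩
        · rw [hfix]
          exact Cm' k le_rfl
    have Cs : ∀ z, C z → C (σ z) := by
      rintro z ⟨k, hk, rfl | rfl⟩
      · exact ⟨k, hk, .inr rfl⟩
      · exact ⟨k, hk, .inl (hσ _)⟩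
    have key : ∀ a b, Relation.EqvGen (fun a b => b = m a ∨ b = σ a) a b → (C a ↔ C b) := by
      intro a b h
      induction h with
      | rel a b h =>
        rcases h with rfl | rfl
        · exact ⟨Cm a, fun h => hm a ▸ Cm _ h⟩
        · exact ⟨Cs a, fun h => hσ a ▸ Cs _ h⟩
      | refl => rfl
      | symm _ _ _ ih => exact ih.symm
      | trans _ _ _ _ _ ih ih' => exact ih.trans ih'
    obtain ⟨k, hk, h⟩ := (key x y hxy).1 ⟨0, Nat.zero_le _, .inl rfl⟩
    have h' : y = p^[k] x := by
      rcases h with h | h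
      · exact h
      · rw [← hσ (p^[k] x), ← h, hy]
    rcases hk.lt_or_eq with hlt | rfl
    · rcases Nat.eq_zero_or_pos k with rfl | hpos
      · exact absurd h' hyx
      · exact absurd ⟨hpos, by rw [← h', hy]⟩ (hmin k hlt)
    · exact h'

/-- An end of the multipole resulting from a junction pattern `σ`, as an end of `M`. -/
def glueEmb {S : Type} (M : Multipole S) (σ : S → S) :
    M.V × Fin 3 ⊕ {s // σ s = s} → M.Ends :=
  Sum.map id Subtype.val

theorem existsUnique_glueMate {S : Type} [Finite S] (M : Multipole S) (σ : S → S)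
    (hσ : ∀ s, σ (σ s) = s) (x : M.V × Fin 3 ⊕ {s // σ s = s}) :
    ∃! y : M.V × Fin 3 ⊕ {s // σ s = s}, y ≠ x ∧
      Relation.EqvGen (fun a b => b = M.mate a ∨ b = Sum.map id σ a)
        (glueEmb M σ x) (glueEmb M σ y) := by
  have hfin := M.fin
  have hinj : Function.Injective (glueEmb M σ) :=
    Function.injective_id.sumMap Subtype.val_injective
  have hfix : ∀ y, Sum.map id σ (glueEmb M σ y) = glueEmb M σ y := by
    rintro (y | ⟨s, hs⟩)
    · rfl
    · exact congrArg Sum.inr hs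
  obtain ⟨z, ⟨hz, hzx, hxz⟩, huniq⟩ := existsUnique_chain_end M.mate (Sum.map id σ)
    M.mate_mate M.mate_ne (by rintro (y | s) <;> simp [hσ]) (glueEmb M σ x) (hfix x)
  obtain ⟨y, rfl⟩ : ∃ y, glueEmb M σ y = z := by
    rcases z with z | s
    · exact ⟨.inl z, rfl⟩
    · exact ⟨.inr ⟨s, Sum.inr.inj hz⟩, rfl⟩
  exact ⟨y, ⟨fun h => hzx (by rw [h]), hxz⟩,
    fun y' hy' => hinj (huniq _ ⟨hfix y', fun h => hy'.1 (hinj h), hy'.2⟩)⟩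

/-- The multipole obtained from `M` by performing the junction of the semiedges `s` and `σ s` for all
`s` with `σ s ≠ s`; the fixed points of the involution `σ` remain semiedges. The two ends of an edge
of the result are the ends of `M` joined by a chain consisting of edges of `M` and of junctions. (A
closed chain, which would give an edge without ends, is discarded.) -/
noncomputable def glue {S : Type} [Finite S] (M : Multipole S) (σ : S → S)
    (hσ : ∀ s, σ (σ s) = s) : Multipole {s // σ s = s} where
  V := M.V
  fin := M.fin
  mate x := (existsUnique_glueMate M σ hσ x).choose
  mate_mate x := by
    have h := (existsUnique_glueMate M σ hσ x).choose_spec.1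
    exact ((existsUnique_glueMate M σ hσ _).choose_spec.2 x ⟨h.1.symm, h.2.symm⟩).symm
  mate_ne x := (existsUnique_glueMate M σ hσ x).choose_spec.1.1

/-- Renaming of the semiedges. -/
def relabel {S R : Type} (M : Multipole S) (e : S ≃ R) : Multipole R where
  V := M.V
  fin := M.fin
  mate x := Sum.map id e (M.mate (Sum.map id e.symm x))
  mate_mate x := by
    have h : ∀ y : M.Ends, Sum.map id e.symm (Sum.map id e y) = y := by
      rintro (y | y) <;> simp
    have h' : Sum.map id e (Sum.map id e.symm x) = x := by
      rcases x with x | x <;> simp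
    rw [h, M.mate_mate, h']
  mate_ne x hx := by
    have h : ∀ y : M.Ends, Sum.map id e.symm (Sum.map id e y) = y := by
      rintro (y | y) <;> simp
    exact M.mate_ne (Sum.map id e.symm x) (by rw [← h (M.mate _), hx])

end Multipole

/-! ### Halin snarks and Halin `(2,2)`-poles -/

/-- The building blocks of a Halin snark: the tree `S'`, the bipartite poles `B_i`, and the
decollineators `D_i` for those `i` that satisfy `keep`. -/
inductive Piece {k : ℕ} (keep : Fin k → Prop) where
  | tree
  | bip (i : Fin k)
  | dec (i : Fin k) (h : keep i)

instance {k : ℕ} (keep : Fin k → Prop) : Finite (Piece keep) :=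
  Finite.of_injective
    (fun x : Piece keep => (match x with
      | .tree => .inl ()
      | .bip i => .inr (.inl i)
      | .dec i _ => .inr (.inr i) : Unit ⊕ Fin k ⊕ Fin k))
    (by rintro (_ | _ | _) (_ | _ | _) h <;> simp_all)

/-- The semiedges of a building block. -/
def Piece.Label {k : ℕ} {keep : Fin k → Prop} : Piece keep → Type
  | .tree => Fin k
  | .bip _ => Label221
  | .dec _ _ => Label22

/-- The building block itself. -/
noncomputable def Piece.pole {k : ℕ} [NeZero k] {keep : Fin k → Prop} (H : CubicHalinGraph k)
    (D : Fin k → Multipole Label22) (B : Fin k → Multipole Label221) :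
    (x : Piece keep) → Multipole x.Label
  | .tree => H.treePole
  | .bip i => B i
  | .dec i _ => D i

instance : Finite Label22 :=
  Finite.of_injective
    (fun x : Label22 => (match x with | .inp s => .inl s | .out s => .inr s : Fin 2 ⊕ Fin 2))
    (by rintro (_ | _) (_ | _) h <;> simp_all)

instance : Finite Label221 :=
  Finite.of_injective
    (fun x : Label221 => (match x with
      | .inp s => .inl s | .out s => .inr (.inl s) | .res => .inr (.inr ()) :
        Fin 2 ⊕ Fin 2 ⊕ Unit))
    (by rintro (_ | _ | _) (_ | _ | _) h <;> simp_all)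

instance {k : ℕ} {keep : Fin k → Prop} (x : Piece keep) : Finite x.Label := by
  cases x
  · exact inferInstanceAs (Finite (Fin k))
  · exact inferInstanceAs (Finite Label221)
  · exact inferInstanceAs (Finite Label22)

/-- The junctions. The output connector of `D_i` is joined to the input connector of `B_i`, the
output connector of `B_i` to the input connector of `D_{i+1}` (indices modulo `k`), and the residual
semiedge of `B_i` to the semiedge `i` of the tree. Semiedges whose partner would belong to a missing
decollineator are fixed points. (The two ways of joining a pair of connectors differ by a renaming of
the semiedges of the decollineator.) -/
def junction {k : ℕ} [NeZero k] (keep : Fin k → Prop) [DecidablePred keep] :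
    (Σ x : Piece keep, x.Label) → Σ x : Piece keep, x.Label
  | ⟨.tree, i⟩ => ⟨.bip i, Label221.res⟩
  | ⟨.bip i, .res⟩ => ⟨.tree, i⟩
  | ⟨.bip i, .inp s⟩ =>
      if h : keep i then ⟨.dec i h, Label22.out s⟩ else ⟨.bip i, Label221.inp s⟩
  | ⟨.bip i, .out s⟩ =>
      if h : keep (i + 1) then ⟨.dec (i + 1) h, Label22.inp s⟩ else ⟨.bip i, Label221.out s⟩
  | ⟨.dec i _, .out s⟩ => ⟨.bip i, Label221.inp s⟩
  | ⟨.dec i _, .inp s⟩ => ⟨.bip (i - 1), Label221.out s⟩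

/-- The semiedges of all building blocks, listed without dependent types. -/
def Piece.code {k : ℕ} {keep : Fin k → Prop} :
    (Σ x : Piece keep, x.Label) → Fin k ⊕ (Fin k × Label221) ⊕ (Fin k × Label22)
  | ⟨.tree, i⟩ => .inl i
  | ⟨.bip i, l⟩ => .inr (.inl (i, l))
  | ⟨.dec i _, l⟩ => .inr (.inr (i, l))

theorem Piece.dec_congr {k : ℕ} {keep : Fin k → Prop} {i i' : Fin k} (e : i = i') (h : keep i)
    (h' : keep i') (l : Label22) :
    (⟨.dec i h, l⟩ : Σ x : Piece keep, x.Label) = ⟨.dec i' h', l⟩ := by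
  subst e
  rfl

theorem junction_junction {k : ℕ} [NeZero k] (keep : Fin k → Prop) [DecidablePred keep]
    (x : Σ x : Piece keep, x.Label) : junction keep (junction keep x) = x := by
  obtain ⟨_ | i | ⟨i, hi⟩, l⟩ := x
  · rfl
  · rcases (l : Label221) with s | s | _
    · by_cases h : keep i <;> simp [junction, h]
    · by_cases h : keep (i + 1)
      · simp only [junction, h, dif_pos]
        rw [add_sub_cancel_right]
      · simp [junction, h]
    · rfl
  · rcases (l : Label22) with s | s
    · have h : keep (i - 1 + 1) := by rwa [sub_add_cancel]
      simp only [junction, h, dif_pos]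
      exact Piece.dec_congr (sub_add_cancel i 1) _ _ _
    · simp [junction, hi]

/-- The building blocks with all their junctions performed. -/
noncomputable def assemble {k : ℕ} [NeZero k] (H : CubicHalinGraph k)
    (D : Fin k → Multipole Label22) (B : Fin k → Multipole Label221)
    (keep : Fin k → Prop) [DecidablePred keep] :
    Multipole {s : Σ x : Piece keep, x.Label // junction keep s = s} :=
  (Multipole.sigma (Piece.pole H D B)).glue (junction keep) (junction_junction keep)

theorem isEmpty_semiedges {k : ℕ} [NeZero k] :
    IsEmpty {s : Σ x : Piece (fun _ : Fin k => True), x.Label // junction (fun _ => True) s = s} := by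
  constructor
  rintro ⟨⟨_ | i | ⟨i, hi⟩, l⟩, h⟩ <;> replace h := congrArg Piece.code h
  · simp [junction, Piece.code] at h
  · rcases (l : Label221) with s | s | _ <;> simp [junction, Piece.code] at h
  · rcases (l : Label22) with s | s <;> simp [junction, Piece.code] at h

/-- The Halin snark obtained from `H` by substituting `v_i` with the Halin fragment
`F_i = D_i ∘ B_i`. -/
noncomputable def halinSnark {k : ℕ} [NeZero k] (H : CubicHalinGraph k)
    (D : Fin k → Multipole Label22) (B : Fin k → Multipole Label221) : CubicGraph :=
  (assemble H D B (fun _ => True)).relabel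
    (have := isEmpty_semiedges (k := k); Equiv.equivOfIsEmpty _ _)

/-- When `D_j` is missing, four semiedges are left: the input semiedges of `B_j` and the output
semiedges of the preceding `B_{j-1}`. They form the input and the output connector. -/
def halinLabel {k : ℕ} [NeZero k] (j : Fin k) :
    Label22 → {s : Σ x : Piece (fun i : Fin k => i ≠ j), x.Label // junction (fun i => i ≠ j) s = s}
  | .inp s => ⟨⟨.bip j, Label221.inp s⟩, by simp [junction]⟩
  | .out s => ⟨⟨.bip (j - 1), Label221.out s⟩, by simp [junction]⟩

theorem halinLabel_bijective {k : ℕ} [NeZero k] (j : Fin k) :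
    Function.Bijective (halinLabel j) := by
  constructor
  · rintro (s | s) (t | t) h <;>
      replace h := congrArg (fun z => Piece.code z.1) h <;>
      simp [halinLabel, Piece.code] at h <;> rw [h]
  · rintro ⟨⟨_ | i | ⟨i, hi⟩, l⟩, h⟩ <;> have h' := congrArg Piece.code h
    · simp [junction, Piece.code] at h'
    · rcases (l : Label221) with s | s | _
      · by_cases hi : i = j
        · subst hi
          exact ⟨.inp s, rfl⟩
        · simp [junction, hi, Piece.code] at h'
      · by_cases hi : i + 1 = j
        · obtain rfl : i = j - 1 := by rw [← hi, add_sub_cancel_right]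
          exact ⟨.out s, rfl⟩
        · simp [junction, hi, Piece.code] at h'
      · simp [junction, Piece.code] at h'
    · rcases (l : Label22) with s | s <;> simp [junction, Piece.code] at h'

/-- The Halin `(2,2)`-pole obtained from the Halin snark by removing the decollineator `D_j`. Its
input connector is formed by the input semiedges of `B_j`, its output connector by the output
semiedges of the preceding fragment. -/
noncomputable def halinPole {k : ℕ} [NeZero k] (H : CubicHalinGraph k)
    (D : Fin k → Multipole Label22) (B : Fin k → Multipole Label221) (j : Fin k) :
    Multipole Label22 :=
  (assemble H D B (fun i => i ≠ j)).relabel (Equiv.ofBijective _ (halinLabel_bijective j)).symm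

/-! ### Weights of points and shapes of pairs -/

/-! Give a corner point weight 1 and a midpoint weight 2 (`Tetrahedron.wt`). A line is corner,
midpoint, corner, so at each vertex a flow obeys two laws: the values sum to 0 and the weights sum
to 4. The shape of a pair of points is determined by the sum of the two weights and the weight of
the sum, so the bookkeeping takes place among six shapes.

In a bipartite pole, a count signed by the colour classes (`IsBipartitePole.sum_eq`) turns the
vertex laws into relations between the semiedges alone: the four connector values add up to the
residual value, and their weights to 4 plus its weight. Hence the input and output shapes are
`Linked`. By Kirchhoff's law a decollineator preserves the weight of the shape; as `hl` is the only
shape of weight 1, it occurs at neither end of a decollineator.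

Root S at v_j. The contour walk makes the leaves below each edge an interval i, …, l, so the
fragments there form a chain from the input of B_i to the output of B_l. Where two sibling subtrees
meet, their chains are joined through one decollineator, and the three edge weights are 1, 1, 2 in
some order; a finite check (`Linked.comp`) makes the end shapes `StronglyLinked`. Induction along
the tree (`CubicHalinGraph.contour_induction`) gives this for the chain of all leaves except v_j.
Joining B_j to that chain through D_{j+1}, where the residual value of B_j is the value on the root
edge, leaves only ls → ls and hl → hl (`Linked.close`). -/

instance : DecidableEq Shape := fun a b => by
  cases a <;> cases b <;> first | exact isTrue rfl | exact isFalse (by rintro ⟨⟩)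

instance : Fintype Shape :=
  ⟨{.ls, .hl, .ang, .alt, .ax, .dpt}, fun x => by cases x <;> decide⟩

/-- The weight of the sum of a pair of the given shape. -/
def Shape.weight : Shape → ℕ
  | .ls => 2
  | .hl => 1
  | .ang => 2
  | .alt => 3
  | .ax => 4
  | .dpt => 0

/-- The shape of a pair of points, determined by the sum of the weights of the two points and by the
weight of their sum. -/
def Shape.ofWeights : ℕ → ℕ → Shape
  | 2, 2 => .ls
  | 3, 1 => .hl
  | 3, 3 => .alt
  | 4, 2 => .ang
  | 4, 4 => .ax
  | _, _ => .dpt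

/-- The restrictions which an equation `u + v + w = 0` in `𝔽₂⁴` puts on the weights. -/
def WeightTriangle (a b c : ℕ) : Prop :=
  a ≤ b + c ∧ b ≤ a + c ∧ c ≤ a + b ∧ (a + b + c) % 2 = 0

instance (a b c : ℕ) : Decidable (WeightTriangle a b c) := by
  unfold WeightTriangle
  infer_instance

theorem vec_add_self (x : Vec) : x + x = 0 := CharTwo.add_self_eq_zero x

theorem vec_add_add_cancel (x y z : Vec) : x + y + (y + z) = x + z := by
  rw [add_assoc, ← add_assoc y, vec_add_self, zero_add]

/-- Every coordinate lies in none or in exactly two of the supports of u, v and u + v. -/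
theorem hammingNorm_triangle : ∀ u v : Vec,
    WeightTriangle (hammingNorm u) (hammingNorm v) (hammingNorm (u + v)) := by
  decide +kernel

/-- Each entry of the list is one shape, except that double points account for two: (2, 0) at a
corner and (4, 0) at a midpoint. Both fall under the last case of `Shape.ofWeights`. -/
theorem hammingNorm_pair : ∀ u v : Vec, hammingNorm u = 1 ∨ hammingNorm u = 2 →
    hammingNorm v = 1 ∨ hammingNorm v = 2 →
    (hammingNorm u + hammingNorm v, hammingNorm (u + v)) ∈
      [(2, 0), (4, 0), (2, 2), (3, 1), (3, 3), (4, 2), (4, 4)] := by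
  decide +kernel

theorem hammingNorm_eq_one : ∀ u : Vec, hammingNorm u = 1 → ∃ i, u = Pi.single i 1 := by
  decide +kernel

theorem hammingNorm_eq_two : ∀ u : Vec, hammingNorm u = 2 →
    ∃ i j, i ≠ j ∧ u = Pi.single i 1 + Pi.single j 1 := by
  decide +kernel

/-! ### Coordinates, weights and shapes relative to a tetrahedron -/

namespace Tetrahedron

variable (T : Tetrahedron)

/-- The basis of corner points. -/
noncomputable def basis : Module.Basis (Fin 4) (ZMod 2) Vec :=
  basisOfLinearIndependentOfCardEqFinrank T.indep (by simp)

/-- The coordinates of a vector with respect to the corner points. -/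
noncomputable def coord : Vec ≃ₗ[ZMod 2] Vec := T.basis.equivFun

theorem coord_corner (i : Fin 4) : T.coord (T.corner i) = Pi.single i 1 := by
  have h : T.basis i = T.corner i := by simp [basis]
  ext j
  rw [← h, coord, Module.Basis.equivFun_self, Pi.single_apply]
  simp [eq_comm]

/-- The number of corner points in the representation of `x`. -/
noncomputable def wt (x : Vec) : ℕ := hammingNorm (T.coord x)

theorem wt_zero : T.wt 0 = 0 := by simp [wt]

theorem wt_corner (i : Fin 4) : T.wt (T.corner i) = 1 := by
  rw [wt, coord_corner]
  revert i
  decide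

theorem wt_corner_add (i j : Fin 4) (h : i ≠ j) : T.wt (T.corner i + T.corner j) = 2 := by
  rw [wt, map_add, coord_corner, coord_corner]
  revert i j
  decide

theorem wt_corner_add₃ (i j l : Fin 4) (h : i ≠ j) (h' : i ≠ l) (h'' : j ≠ l) :
    T.wt (T.corner i + (T.corner j + T.corner l)) = 3 := by
  rw [wt, map_add, map_add, coord_corner, coord_corner, coord_corner]
  revert i j l
  decide

theorem wt_corner_add₄ (a b c d : Fin 4) (h₁ : a ≠ b) (h₂ : a ≠ c) (h₃ : a ≠ d) (h₄ : b ≠ c)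
    (h₅ : b ≠ d) (h₆ : c ≠ d) :
    T.wt (T.corner a + T.corner b + (T.corner c + T.corner d)) = 4 := by
  have : ∀ a b c d : Fin 4, a ≠ b ∧ a ≠ c ∧ a ≠ d ∧ b ≠ c ∧ b ≠ d ∧ c ≠ d →
      hammingNorm (Pi.single a 1 + Pi.single b 1 + (Pi.single c 1 + Pi.single d 1) : Vec) = 4 := by
    decide +kernel
  simpa only [wt, map_add, coord_corner] using this a b c d ⟨h₁, h₂, h₃, h₄, h₅, h₆⟩

theorem mem_points {x : Vec} : x ∈ T.points ↔ T.wt x = 1 ∨ T.wt x = 2 := by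
  constructor
  · rintro (⟨i, rfl⟩ | ⟨i, j, h, rfl⟩)
    · exact .inl (T.wt_corner i)
    · exact .inr (T.wt_corner_add i j h)
  · rintro (h | h)
    · obtain ⟨i, hi⟩ := hammingNorm_eq_one _ h
      exact .inl ⟨i, T.coord.injective (by rw [hi, coord_corner])⟩
    · obtain ⟨i, j, hij, h⟩ := hammingNorm_eq_two _ h
      exact .inr ⟨i, j, hij, T.coord.injective (by rw [h, map_add, coord_corner, coord_corner])⟩

theorem wt_eq_one {x : Vec} (h : T.wt x = 1) : ∃ i, x = T.corner i := by
  obtain ⟨i, hi⟩ := hammingNorm_eq_one _ h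
  exact ⟨i, T.coord.injective (by rw [hi, coord_corner])⟩

theorem wt_triangle (x y : Vec) : WeightTriangle (T.wt x) (T.wt y) (T.wt (x + y)) := by
  simpa only [wt, map_add] using hammingNorm_triangle (T.coord x) (T.coord y)

theorem wt_pair {x y : Vec} (hx : x ∈ T.points) (hy : y ∈ T.points) :
    (T.wt x + T.wt y, T.wt (x + y)) ∈
      [(2, 0), (4, 0), (2, 2), (3, 1), (3, 3), (4, 2), (4, 4)] := by
  rw [mem_points] at hx hy
  simpa only [wt, map_add] using hammingNorm_pair _ _ hx hy

/-- The shape of the pair `{x, y}`. -/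
noncomputable def shape (x y : Vec) : Shape := Shape.ofWeights (T.wt x + T.wt y) (T.wt (x + y))

/-- Translates relations between sums of pairs, such as Kirchhoff's law, into conditions on shapes
that can be checked by enumeration. -/
theorem weight_shape {x y : Vec} (hx : x ∈ T.points) (hy : y ∈ T.points) :
    (T.shape x y).weight = T.wt (x + y) := by
  have h := T.wt_pair hx hy
  unfold shape
  generalize T.wt x + T.wt y = m at *
  generalize T.wt (x + y) = n at *
  fin_cases h <;> rfl

theorem corner_ne {i j : Fin 4} (h : i ≠ j) : T.corner i ≠ T.corner j := by
  intro e
  have := T.wt_corner_add i j h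
  rw [e, vec_add_self, wt_zero] at this
  omega

theorem shape_comm (x y : Vec) : T.shape x y = T.shape y x := by
  rw [shape, shape, add_comm (T.wt x), add_comm x]

theorem mem_pairs_of_shape_eq_ls {x y : Vec} (hx : x ∈ T.points) (hy : y ∈ T.points)
    (h : T.shape x y = .ls) : s(x, y) ∈ T.pairs .ls := by
  have hp := T.wt_pair hx hy
  rw [mem_points] at hx hy
  have : T.wt x = 1 ∧ T.wt y = 1 ∧ T.wt (x + y) = 2 := by
    unfold shape at h
    rcases hx with hx | hx <;> rcases hy with hy | hy <;> rw [hx, hy] at h hp <;>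
      generalize T.wt (x + y) = n at * <;> simp at hp <;>
      rcases hp with rfl | hp <;> (try rcases hp with rfl | rfl) <;> simp_all [Shape.ofWeights]
  obtain ⟨i, rfl⟩ := T.wt_eq_one this.1
  obtain ⟨j, rfl⟩ := T.wt_eq_one this.2.1
  refine ⟨i, j, ?_, rfl⟩
  rintro rfl
  have := this.2.2
  rw [vec_add_self, wt_zero] at this
  omega

theorem mem_pairs_of_wt_eq_one {x y : Vec} (hx : T.wt x = 1) (hy : T.wt y = 2)
    (h : T.wt (x + y) = 1) : s(x, y) ∈ T.pairs .hl := by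
  obtain ⟨i, rfl⟩ := T.wt_eq_one hx
  obtain ⟨j, hj⟩ := T.wt_eq_one h
  have hy' : y = T.corner i + T.corner j := by
    rw [← hj, ← add_assoc, vec_add_self, zero_add]
  refine ⟨i, j, ?_, by rw [hy']⟩
  rintro rfl
  rw [hy', vec_add_self, wt_zero] at hy
  omega

theorem mem_pairs_of_shape_eq_hl {x y : Vec} (hx : x ∈ T.points) (hy : y ∈ T.points)
    (h : T.shape x y = .hl) : s(x, y) ∈ T.pairs .hl := by
  have hp := T.wt_pair hx hy
  rw [mem_points] at hx hy
  have : (T.wt x = 1 ∧ T.wt y = 2 ∨ T.wt x = 2 ∧ T.wt y = 1) ∧ T.wt (x + y) = 1 := by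
    unfold shape at h
    rcases hx with hx | hx <;> rcases hy with hy | hy <;> rw [hx, hy] at h hp <;>
      generalize T.wt (x + y) = n at * <;> simp at hp <;>
      rcases hp with rfl | hp <;> (try rcases hp with rfl | rfl) <;> simp_all [Shape.ofWeights]
  obtain ⟨⟨hx, hy⟩ | ⟨hx, hy⟩, hxy⟩ := this
  · exact T.mem_pairs_of_wt_eq_one hx hy hxy
  · rw [Sym2.eq_swap]
    exact T.mem_pairs_of_wt_eq_one hy hx (by rwa [add_comm])

theorem shape_eq_of_sym2_eq {x y a b : Vec} (h : s(x, y) = s(a, b)) :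
    T.shape x y = T.shape a b := by
  rcases Sym2.eq_iff.1 h with ⟨rfl, rfl⟩ | ⟨rfl, rfl⟩
  · rfl
  · exact T.shape_comm _ _

/-- The six shapes exclude each other, so a result on `T.shape` controls every entry of
`shapeTransitions`. -/
theorem shape_of_mem_pairs {σ : Shape} {x y : Vec} (h : s(x, y) ∈ T.pairs σ) :
    T.shape x y = σ := by
  cases σ
  · obtain ⟨a, b, hab, h⟩ := h
    rw [T.shape_eq_of_sym2_eq h, shape, wt_corner, wt_corner, wt_corner_add _ _ _ hab]
    rfl
  · obtain ⟨a, b, hab, h⟩ := h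
    rw [T.shape_eq_of_sym2_eq h, shape, wt_corner, wt_corner_add _ _ _ hab, ← add_assoc,
      vec_add_self, zero_add, wt_corner]
    rfl
  · obtain ⟨a, b, c, hab, hac, hbc, h⟩ := h
    rw [T.shape_eq_of_sym2_eq h, shape, wt_corner_add _ _ _ hab, wt_corner_add _ _ _ hac,
      add_add_add_comm, vec_add_self, zero_add, wt_corner_add _ _ _ hbc]
    rfl
  · obtain ⟨a, b, c, hab, hac, hbc, h⟩ := h
    rw [T.shape_eq_of_sym2_eq h, shape, wt_corner, wt_corner_add _ _ _ hbc,
      wt_corner_add₃ _ _ _ _ hab hac hbc]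
    rfl
  · obtain ⟨a, b, c, d, h₁, h₂, h₃, h₄, h₅, h₆, h⟩ := h
    rw [T.shape_eq_of_sym2_eq h, shape, wt_corner_add _ _ _ h₁, wt_corner_add _ _ _ h₆,
      wt_corner_add₄ _ _ _ _ _ h₁ h₂ h₃ h₄ h₅ h₆]
    rfl
  · obtain ⟨z, hz, h⟩ := h
    rw [T.shape_eq_of_sym2_eq h, shape, vec_add_self, wt_zero]
    rcases T.mem_points.1 hz with e | e <;> rw [e] <;> rfl

theorem exists_line_of_shape {x y : Vec} (hx : x ∈ T.points) (hy : y ∈ T.points)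
    (h : T.shape x y = .ls ∨ T.shape x y = .hl) :
    x + y ≠ 0 ∧ ∃ l ∈ T.lines, x ∈ l ∧ y ∈ l := by
  constructor
  · intro h0
    have := T.weight_shape hx hy
    rw [h0, wt_zero] at this
    rcases h with h | h <;> rw [h] at this <;> cases this
  · rcases h with h | h
    · obtain ⟨i, j, hij, h⟩ := T.mem_pairs_of_shape_eq_ls hx hy h
      refine ⟨_, ⟨i, j, hij, rfl⟩, ?_⟩
      rcases Sym2.eq_iff.1 h with ⟨rfl, rfl⟩ | ⟨rfl, rfl⟩ <;> simp
    · obtain ⟨i, j, hij, h⟩ := T.mem_pairs_of_shape_eq_hl hx hy h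
      refine ⟨_, ⟨i, j, hij, rfl⟩, ?_⟩
      rcases Sym2.eq_iff.1 h with ⟨rfl, rfl⟩ | ⟨rfl, rfl⟩ <;> simp

/-- Sums over the three values at a vertex of a `T`-flow. -/
theorem sum_of_range_eq {A : Type*} [AddCommMonoid A] (g : Vec → A) {f : Fin 3 → Vec}
    {i j : Fin 4} (hij : i ≠ j)
    (h : Set.range f = {T.corner i, T.corner i + T.corner j, T.corner j}) :
    ∑ a, g (f a) = g (T.corner i) + (g (T.corner i + T.corner j) + g (T.corner j)) := by
  have ne {x y : Vec} (h : T.wt x ≠ T.wt y) : x ≠ y := fun e => h (by rw [e])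
  have h₁ : T.corner i ≠ T.corner i + T.corner j :=
    ne (by rw [wt_corner, wt_corner_add _ _ _ hij]; decide)
  have h₂ : T.corner i + T.corner j ≠ T.corner j :=
    ne (by rw [wt_corner, wt_corner_add _ _ _ hij]; decide)
  have h₃ := T.corner_ne hij
  have himg : Finset.univ.image f = {T.corner i, T.corner i + T.corner j, T.corner j} := by
    rw [← Finset.coe_inj]
    simpa using h
  -- A map from three indices onto a line of three points is injective, so no value is repeated in
  -- the sum.
  have hcard : ({T.corner i, T.corner i + T.corner j, T.corner j} : Finset Vec).card = 3 :=
    Finset.card_eq_three.2 ⟨_, _, _, h₁, h₃, h₂, rfl⟩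
  have hinj : Set.InjOn f (Finset.univ : Finset (Fin 3)) := by
    rw [← Finset.card_image_iff, himg, hcard]
    rfl
  rw [← Finset.sum_image (f := g) hinj, himg, Finset.sum_insert, Finset.sum_insert,
    Finset.sum_singleton]
  · simpa using h₂
  · rw [Finset.mem_insert, Finset.mem_singleton]
    exact not_or.2 ⟨h₁, h₃⟩

theorem sum_line {f : Fin 3 → Vec} (h : Set.range f ∈ T.lines) : ∑ a, f a = 0 := by
  obtain ⟨i, j, hij, h⟩ := h
  rw [T.sum_of_range_eq (fun x => x) hij h, add_assoc, vec_add_self, add_zero, vec_add_self]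

/-- An integer-valued law, 1 + 2 + 1, in addition to the vanishing of the sum in 𝔽₂⁴. -/
theorem sum_wt_line {f : Fin 3 → Vec} (h : Set.range f ∈ T.lines) : ∑ a, T.wt (f a) = 4 := by
  obtain ⟨i, j, hij, h⟩ := h
  rw [T.sum_of_range_eq T.wt hij h, wt_corner, wt_corner, wt_corner_add _ _ _ hij]
  rfl

end Tetrahedron

/-! ### Conservation laws for flows on poles -/

/-- Semiedges of a `(2,2)`-pole, listed by connector. -/
def Label22.equiv : Fin 2 ⊕ Fin 2 ≃ Label22 where
  toFun := Sum.elim .inp .out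
  invFun | .inp s => .inl s | .out s => .inr s
  left_inv := by rintro (_ | _) <;> rfl
  right_inv := by rintro (_ | _) <;> rfl

/-- Semiedges of a `(2,2;1)`-pole, listed by connector. -/
def Label221.equiv : (Fin 2 ⊕ Fin 2) ⊕ Unit ≃ Label221 where
  toFun := Sum.elim (Sum.elim .inp .out) (fun _ => .res)
  invFun | .inp s => .inl (.inl s) | .out s => .inl (.inr s) | .res => .inr ()
  left_inv := by rintro ((_ | _) | _) <;> rfl
  right_inv := by rintro (_ | _ | _) <;> rfl

instance : Fintype Label22 := Fintype.ofEquiv _ Label22.equiv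

instance : Fintype Label221 := Fintype.ofEquiv _ Label221.equiv

theorem Label22.sum_eq {A : Type*} [AddCommMonoid A] (F : Label22 → A) :
    ∑ s, F s = F (.inp 0) + F (.inp 1) + (F (.out 0) + F (.out 1)) := by
  rw [← Label22.equiv.sum_comp]
  simp [Label22.equiv, Fin.sum_univ_two]

theorem Label221.sum_eq {A : Type*} [AddCommMonoid A] (F : Label221 → A) :
    ∑ s, F s = F (.inp 0) + F (.inp 1) + (F (.out 0) + F (.out 1)) + F .res := by
  rw [← Label221.equiv.sum_comp]
  simp [Label221.equiv, Fin.sum_univ_two]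

namespace Multipole

theorem sum_ends_eq_zero {S : Type} [Fintype S] (M : Multipole S) [Fintype M.V] {A : Type*}
    [AddCommGroup A] (F : M.Ends → A) (h : ∀ x, F x + F (M.mate x) = 0) :
    (∑ v : M.V, ∑ a, F (.inl (v, a))) + ∑ s, F (.inr s) = 0 := by
  rw [← Fintype.sum_prod_type' (fun v a => F (.inl (v, a))), ← Fintype.sum_sum_type]
  exact Finset.sum_involution (fun x _ => M.mate x) (fun x _ => h x)
    (fun x _ _ => M.mate_ne x) (fun _ _ => Finset.mem_univ _) (fun x _ => M.mate_mate x)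

/-- Kirchhoff's law for `(2,2)`-poles. -/
theorem IsTFlow.sum_inp_eq {T : Tetrahedron} {X : Multipole Label22} {φ : X.Ends → Vec}
    (hφ : X.IsTFlow T φ) :
    φ (.inr (.inp 0)) + φ (.inr (.inp 1)) = φ (.inr (.out 0)) + φ (.inr (.out 1)) := by
  have := X.fin
  have := Fintype.ofFinite X.V
  have h := X.sum_ends_eq_zero φ (fun x => by rw [hφ.edge, vec_add_self])
  rw [Finset.sum_eq_zero (fun v _ => T.sum_line (hφ.line v)), zero_add, Label22.sum_eq] at h
  exact CharTwo.add_eq_zero.1 h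

end Multipole

/-- Sign each end by the colour of its vertex in `G`. Mates carry opposite signs, so the signed
total vanishes; u and v share a sign and w has the other. The group `A` is 𝔽₂⁴ for the values and ℤ
for the weights. -/
theorem IsBipartitePole.sum_eq {B : Multipole Label221} (hB : IsBipartitePole B) {A : Type*}
    [AddCommGroup A] (g : B.Ends → A) (hg : ∀ x, g (B.mate x) = g x) (c : A)
    (hc : ∀ v, ∑ a, g (.inl (v, a)) = c) :
    g (.inr (.inp 0)) + g (.inr (.inp 1)) + (g (.inr (.out 0)) + g (.inr (.out 1)))
      = c + g (.inr .res) := by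
  have := B.fin
  have := Fintype.ofFinite B.V
  obtain ⟨G, u, w, v, ⟨col, hcol⟩, -, -, -, f, -, hf, ⟨e, he⟩, hu, hv, hw, a, b, b', d, huw, hwv,
    -⟩ := hB
  let sgn : G.V → ℤ := fun x => if col x then 1 else -1
  have hsgn : ∀ x y, col x ≠ col y → sgn y = -sgn x := by
    intro x y h
    simp only [sgn]
    cases hx : col x <;> cases hy : col y <;> simp_all
  have hw' : sgn w = -sgn u := hsgn _ _ (hcol _ _ _ _ huw)
  have hv' : sgn v = sgn u := by rw [hsgn _ _ (hcol _ _ _ _ hwv), hw', neg_neg]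
  have hmate : ∀ x, sgn (f (B.mate x)).1 = -sgn (f x).1 :=
    fun x => hsgn _ _ (hcol _ (f x).2 _ (f (B.mate x)).2 (hf x))
  have h₁ := B.sum_ends_eq_zero (fun x => sgn (f x).1 • g x)
    (fun x => by rw [hmate, hg, neg_smul, add_neg_cancel])
  -- The count of ends alone: three times the signed number of vertices, plus 4 - 1 times the sign
  -- of u, is 0. So the colour of w has exactly one vertex more in `B`, which is the single `c` in
  -- the conclusion.
  have h₂ := B.sum_ends_eq_zero (fun x => sgn (f x).1) (fun x => by rw [hmate, add_neg_cancel])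
  simp only [he, ← Finset.smul_sum, hc, ← Finset.sum_smul, Label221.sum_eq, hu, hv, hw, hw',
    hv'] at h₁ h₂
  simp only [Finset.sum_const, Finset.card_univ, Fintype.card_fin, ← Finset.smul_sum] at h₂
  have h₃ : ∑ x : B.V, sgn (e x) = -sgn u := by
    simp only [nsmul_eq_mul] at h₂
    push_cast at h₂
    linarith
  rw [h₃] at h₁
  have h₄ : sgn u • (g (.inr (.inp 0)) + g (.inr (.inp 1)) + (g (.inr (.out 0)) +
      g (.inr (.out 1))) - (c + g (.inr .res))) = 0 := by
    rw [← h₁]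
    module
  have h₅ : sgn u = 1 ∨ sgn u = -1 := by
    simp only [sgn]
    split <;> simp
  rw [← sub_eq_zero]
  rcases h₅ with h₅ | h₅ <;> rw [h₅] at h₄
  · rwa [one_smul] at h₄
  · rwa [neg_one_smul, neg_eq_zero] at h₄

/-! ### Transitions through a subtree -/

/-- The pairs of shapes which the fragments attached to a subtree may connect, if the value on the
edge leading to the subtree has weight `n`. -/
def Linked : ℕ → Shape → Shape → Prop
  | 1, .alt, .ls | 1, .ls, .alt | 1, .hl, .ang | 1, .ang, .hl | 1, .hl, .dpt | 1, .dpt, .hl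
  | 1, .hl, .ls | 1, .ls, .hl => True
  | 2, .alt, .alt | 2, .alt, .hl | 2, .hl, .alt | 2, .ang, .dpt | 2, .dpt, .ang | 2, .ang, .ls
  | 2, .ls, .ang | 2, .ax, .ls | 2, .ls, .ax | 2, .dpt, .ls | 2, .ls, .dpt | 2, .hl, .hl
  | 2, .ls, .ls => True
  | _, _, _ => False

/-- The pairs of shapes which the fragments attached to a subtree with more than one leaf may
connect. -/
def StronglyLinked : ℕ → Shape → Shape → Prop
  | 1, .alt, .ls | 1, .ls, .alt | 1, .hl, .ang | 1, .ang, .hl | 1, .hl, .dpt | 1, .dpt, .hl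
  | 1, .hl, .ls | 1, .ls, .hl => True
  | 2, .alt, .hl | 2, .hl, .alt | 2, .hl, .hl | 2, .ls, .ls => True
  | _, _, _ => False

/-- The pairs of shapes which a decollineator may connect. -/
def Decollinear (σ τ : Shape) : Prop :=
  σ.weight = τ.weight ∧ ¬ ((σ = .ls ∨ σ = .hl) ∧ (τ = .ls ∨ τ = .hl))

instance (n : ℕ) (σ τ : Shape) : Decidable (Linked n σ τ) := by
  unfold Linked
  split <;> infer_instance

instance (n : ℕ) (σ τ : Shape) : Decidable (StronglyLinked n σ τ) := by
  unfold StronglyLinked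
  split <;> infer_instance

instance (σ τ : Shape) : Decidable (Decollinear σ τ) := by
  unfold Decollinear
  infer_instance

theorem StronglyLinked.linked {n : ℕ} {σ τ : Shape} (h : StronglyLinked n σ τ) :
    Linked n σ τ := by
  unfold StronglyLinked at h
  split at h <;> trivial

/-- Neither τ nor τ' can be `hl`. For l = m = 1 this alone leaves the four pairs of `StronglyLinked
2`; for n = 1 the triangle condition removes pairs such as `alt`, `dpt`. -/
theorem Linked.comp_fin : ∀ (l m n : Fin 3) (σ τ : Shape), Linked l σ τ → ∀ τ' : Shape,
    Decollinear τ τ' → ∀ ρ : Shape, Linked m τ' ρ → (l + m + n : ℕ) = 4 → n ≠ 0 →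
    WeightTriangle σ.weight ρ.weight n → StronglyLinked n σ ρ := by
  decide +kernel

theorem Linked.comp {l m n : ℕ} {σ τ τ' ρ : Shape} (h : Linked l σ τ) (hd : Decollinear τ τ')
    (h' : Linked m τ' ρ) (hl : 0 < l) (hm : 0 < m) (hn : 0 < n)
    (hs : l + m + n = 4) (hw : WeightTriangle σ.weight ρ.weight n) : StronglyLinked n σ ρ :=
  comp_fin ⟨l, by omega⟩ ⟨m, by omega⟩ ⟨n, by omega⟩ σ τ h τ' hd ρ h' hs (by simp [Fin.ext_iff]; omega) hw

/-- The strong relation is needed: with `Linked` on the second link, `ang`, `ls`, `ang`, `ls` would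
survive for n = 2. -/
theorem Linked.close_fin : ∀ (n : Fin 3) (σ τ : Shape), Linked n σ τ → ∀ τ' : Shape,
    Decollinear τ τ' → ∀ ρ : Shape, StronglyLinked n τ' ρ → σ.weight = ρ.weight →
    (σ = .ls ∧ ρ = .ls) ∨ (σ = .hl ∧ ρ = .hl) := by
  decide +kernel

theorem Linked.close {n : ℕ} {σ τ τ' ρ : Shape} (hn : n = 1 ∨ n = 2) (h : Linked n σ τ)
    (hd : Decollinear τ τ') (h' : StronglyLinked n τ' ρ) (hw : σ.weight = ρ.weight) :
    (σ = .ls ∧ ρ = .ls) ∨ (σ = .hl ∧ ρ = .hl) :=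
  close_fin ⟨n, by omega⟩ σ τ h τ' hd ρ h' hw

/-- A single bipartite pole connects fewer pairs than `Linked` admits: `hl` with `ang` at 1 and `ls`
with `ls` at 2 violate l + m = 4 + n. They are there to absorb compositions. -/
theorem linked_ofWeights {l m n v w : ℕ}
    (hl : (l, v) ∈ [(2, 0), (4, 0), (2, 2), (3, 1), (3, 3), (4, 2), (4, 4)])
    (hm : (m, w) ∈ [(2, 0), (4, 0), (2, 2), (3, 1), (3, 3), (4, 2), (4, 4)])
    (hn : n = 1 ∨ n = 2) (hs : l + m = 4 + n) (hw : WeightTriangle v w n) :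
    Linked n (Shape.ofWeights l v) (Shape.ofWeights m w) := by
  have key : ∀ p ∈ [(2, 0), (4, 0), (2, 2), (3, 1), (3, 3), (4, 2), (4, 4)],
      ∀ q ∈ [(2, 0), (4, 0), (2, 2), (3, 1), (3, 3), (4, 2), (4, 4)], ∀ n ∈ [1, 2],
      p.1 + q.1 = 4 + n → WeightTriangle p.2 q.2 n →
      Linked n (Shape.ofWeights p.1 p.2) (Shape.ofWeights q.1 q.2) := by
    decide +kernel
  exact key _ hl _ hm n (by simpa using hn) hs hw

theorem IsBipartitePole.sum_points {T : Tetrahedron} {B : Multipole Label221}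
    (hB : IsBipartitePole B) {φ : B.Ends → Vec} (hφ : B.IsTFlow T φ) :
    φ (.inr (.inp 0)) + φ (.inr (.inp 1)) + (φ (.inr (.out 0)) + φ (.inr (.out 1)))
      = φ (.inr .res) := by
  rw [hB.sum_eq φ hφ.edge 0 (fun v => T.sum_line (hφ.line v)), zero_add]

theorem IsBipartitePole.linked {T : Tetrahedron} {B : Multipole Label221}
    (hB : IsBipartitePole B) {φ : B.Ends → Vec} (hφ : B.IsTFlow T φ) :
    Linked (T.wt (φ (.inr .res))) (T.shape (φ (.inr (.inp 0))) (φ (.inr (.inp 1))))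
      (T.shape (φ (.inr (.out 0))) (φ (.inr (.out 1)))) := by
  have h := hB.sum_eq (fun x => (T.wt (φ x) : ℤ)) (fun x => by rw [hφ.edge]) 4
    (fun v => by exact_mod_cast T.sum_wt_line (hφ.line v))
  refine linked_ofWeights (T.wt_pair (hφ.point _) (hφ.point _))
    (T.wt_pair (hφ.point _) (hφ.point _)) (T.mem_points.1 (hφ.point _)) (by exact_mod_cast h) ?_
  rw [← hB.sum_points hφ]
  exact T.wt_triangle _ _

theorem IsDecollineator.decollinear {T : Tetrahedron} {X : Multipole Label22}
    (hX : IsDecollineator T X) {φ : X.Ends → Vec} (hφ : X.IsTFlow T φ) :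
    Decollinear (T.shape (φ (.inr (.inp 0))) (φ (.inr (.inp 1))))
      (T.shape (φ (.inr (.out 0))) (φ (.inr (.out 1)))) := by
  constructor
  · rw [T.weight_shape (hφ.point _) (hφ.point _), T.weight_shape (hφ.point _) (hφ.point _),
      hφ.sum_inp_eq]
  · rintro ⟨h, h'⟩
    have h := T.exists_line_of_shape (hφ.point _) (hφ.point _) h
    have h' := T.exists_line_of_shape (hφ.point _) (hφ.point _) h'
    exact hX _ _ ⟨φ, hφ, rfl, rfl⟩ ⟨_, _, _, _, rfl, rfl, h.1, h'.1, h.2, h'.2⟩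

/-! ### Flows on glued multipoles -/

namespace Multipole

variable {T : Tetrahedron} {S : Type}

/-- A flow on the result of a junction extends to the junction edges. -/
theorem IsTFlow.exists_of_glue [Finite S] {M : Multipole S} {σ : S → S}
    {hσ : ∀ s, σ (σ s) = s} {φ : (M.glue σ hσ).Ends → Vec} (hφ : (M.glue σ hσ).IsTFlow T φ) :
    ∃ ψ : M.Ends → Vec, M.IsTFlow T ψ ∧ (∀ s, ψ (.inr (σ s)) = ψ (.inr s)) ∧
      ∀ x, ψ (glueEmb M σ x) = φ x := by
  classical
  let R : M.Ends → M.Ends → Prop :=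
    Relation.EqvGen (fun a b => b = M.mate a ∨ b = Sum.map id σ a)
  -- Two different surviving ends on one chain are mates in the glued multipole, so `φ` agrees on
  -- them.
  have hwd : ∀ x y, R (glueEmb M σ x) (glueEmb M σ y) → φ x = φ y := by
    intro x y h
    by_cases hxy : y = x
    · rw [hxy]
    · rw [(existsUnique_glueMate M σ hσ x).choose_spec.2 y ⟨hxy, h⟩]
      exact (hφ.edge x).symm
  -- The default serves closed chains. They contain no end at a vertex, so any fixed point of `T`
  -- would do.
  let ψ : M.Ends → Vec := fun z =>
    if h : ∃ x, R (glueEmb M σ x) z then φ h.choose else T.corner 0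
  have hψ : ∀ x, ψ (glueEmb M σ x) = φ x := by
    intro x
    have h : ∃ y, R (glueEmb M σ y) (glueEmb M σ x) := ⟨x, .refl _⟩
    simp only [ψ, dif_pos h]
    exact hwd _ _ h.choose_spec
  have hR : ∀ z z', R z z' → ψ z' = ψ z := by
    intro z z' h
    by_cases hz : ∃ x, R (glueEmb M σ x) z
    · have hz' : ∃ x, R (glueEmb M σ x) z' := ⟨hz.choose, hz.choose_spec.trans _ _ _ h⟩
      simp only [ψ, dif_pos hz, dif_pos hz']
      exact hwd _ _ (hz'.choose_spec.trans _ _ _ ((h.symm _ _).trans _ _ _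
        (hz.choose_spec.symm _ _)))
    · have hz' : ¬ ∃ x, R (glueEmb M σ x) z' :=
        fun ⟨x, hx⟩ => hz ⟨x, hx.trans _ _ _ (h.symm _ _)⟩
      simp only [ψ, dif_neg hz, dif_neg hz']
  refine ⟨ψ, ⟨fun x => hR _ _ (.rel _ _ (.inl rfl)), fun z => ?_, fun v => ?_⟩,
    fun s => hR _ _ (.rel _ _ (.inr rfl)), hψ⟩
  · by_cases hz : ∃ x, R (glueEmb M σ x) z
    · simp only [ψ, dif_pos hz]
      exact hφ.point _
    · simp only [ψ, dif_neg hz]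
      exact .inl ⟨0, rfl⟩
  · have h : (fun i : Fin 3 => ψ (.inl (v, i))) = fun i => φ (.inl (v, i)) :=
      funext fun i => hψ (.inl (v, i))
    rw [h]
    exact hφ.line v

theorem IsTFlow.of_relabel {R : Type} {M : Multipole S} {e : S ≃ R}
    {φ : (M.relabel e).Ends → Vec} (hφ : (M.relabel e).IsTFlow T φ) :
    M.IsTFlow T (fun x => φ (Sum.map id e x)) where
  edge x := by
    have h : Sum.map id e.symm (Sum.map id e x) = x := by rcases x with x | x <;> simp
    have h' := hφ.edge (Sum.map id e x)
    simp only [relabel, h] at h'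
    exact h'
  point x := hφ.point _
  line v := hφ.line v

theorem IsTFlow.of_sigma {ι : Type} [Finite ι] {S : ι → Type} {M : ∀ i, Multipole (S i)}
    {φ : (sigma M).Ends → Vec} (hφ : (sigma M).IsTFlow T φ) (i : ι) :
    (M i).IsTFlow T (fun x => φ (sigmaEnd (V := fun i => (M i).V) i x)) where
  edge x := by
    rw [← sigmaMate_sigmaEnd]
    exact hφ.edge _
  point x := hφ.point _
  line v := hφ.line ⟨i, v⟩

end Multipole

/-- A flow on a Halin pole induces compatible flows on its building blocks. -/
theorem exists_flows_of_halinPole {T : Tetrahedron} {k : ℕ} [NeZero k] {H : CubicHalinGraph k}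
    {D : Fin k → Multipole Label22} {B : Fin k → Multipole Label221} {j : Fin k}
    {φ : (halinPole H D B j).Ends → Vec} (hφ : (halinPole H D B j).IsTFlow T φ) :
    ∃ (τ : H.treePole.Ends → Vec) (β : ∀ i, (B i).Ends → Vec),
      H.treePole.IsTFlow T τ ∧ (∀ i, (B i).IsTFlow T (β i)) ∧
      (∀ i, τ (.inr i) = β i (.inr .res)) ∧
      (∀ i, i ≠ j → ∃ δ : (D i).Ends → Vec, (D i).IsTFlow T δ ∧
        (∀ s, δ (.inr (.inp s)) = β (i - 1) (.inr (.out s))) ∧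
        ∀ s, δ (.inr (.out s)) = β i (.inr (.inp s))) ∧
      (∀ s, φ (.inr (.inp s)) = β j (.inr (.inp s))) ∧
      ∀ s, φ (.inr (.out s)) = β (j - 1) (.inr (.out s)) := by
  obtain ⟨ψ, hψ, hσ, hemb⟩ := hφ.of_relabel.exists_of_glue
  have hlabel : ∀ l, φ (.inr l) = ψ (.inr (halinLabel j l).1) := by
    intro l
    refine Eq.trans ?_ (hemb (.inr (halinLabel j l))).symm
    exact congrArg (fun l => φ (.inr l))
      ((Equiv.ofBijective _ (halinLabel_bijective j)).symm_apply_apply l).symm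
  refine ⟨_, _, hψ.of_sigma .tree, fun i => hψ.of_sigma (.bip i), fun i => ?_, fun i hi =>
    ⟨_, hψ.of_sigma (.dec i hi), fun s => ?_, fun s => ?_⟩, fun s => hlabel _, fun s => hlabel _⟩
  · exact (hσ ⟨.tree, i⟩).symm
  · exact (hσ ⟨.dec i hi, Label22.inp s⟩).symm
  · exact (hσ ⟨.dec i hi, Label22.out s⟩).symm

/-! ### The walk around a plane tree -/

/-- Uniqueness of the parent in a rooted tree: the shortest paths to w through x and through y are
the same path, hence have the same penultimate vertex. -/
theorem SimpleGraph.IsTree.eq_of_dist_eq_add_one {V : Type*} {G : SimpleGraph V} (hG : G.IsTree)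
    {r x y w : V} (hx : G.Adj x w) (hy : G.Adj y w) (hdx : G.dist r w = G.dist r x + 1)
    (hdy : G.dist r w = G.dist r y + 1) : x = y := by
  obtain ⟨p, hp⟩ := hG.connected.exists_walk_length_eq_dist r x
  obtain ⟨q, hq⟩ := hG.connected.exists_walk_length_eq_dist r y
  have hp' : (p.concat hx).IsPath :=
    Walk.isPath_of_length_eq_dist _ (by rw [Walk.length_concat, hp, hdx])
  have hq' : (q.concat hy).IsPath :=
    Walk.isPath_of_length_eq_dist _ (by rw [Walk.length_concat, hq, hdy])
  have h := congrArg Walk.penultimate ((hG.existsUnique_path r w).unique hp' hq')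
  simpa using h

namespace CubicHalinGraph

variable {k : ℕ} [NeZero k] (H : CubicHalinGraph k)

/-- A step of the walk around the tree: having come along an edge to a trivalent vertex, the walk
leaves it by the next edge in the cyclic order. -/
def Step (d d' : (H.W ⊕ Fin k) × (H.W ⊕ Fin k)) : Prop :=
  ∃ w a, d = (H.nb w a, .inl w) ∧ d' = (.inl w, H.nb w (a + 1))

variable {H}

theorem Step.unique {d d₁ d₂ : (H.W ⊕ Fin k) × (H.W ⊕ Fin k)} (h₁ : H.Step d d₁)
    (h₂ : H.Step d d₂) : d₁ = d₂ := by
  obtain ⟨w, a, rfl, rfl⟩ := h₁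
  obtain ⟨w', a', h, rfl⟩ := h₂
  obtain ⟨h, h'⟩ := Prod.mk.inj h
  obtain rfl := Sum.inl.inj h'
  rw [H.nb_injective w h]

theorem not_step_leaf {x : H.W ⊕ Fin k} {i : Fin k} {d : (H.W ⊕ Fin k) × (H.W ⊕ Fin k)} :
    ¬ H.Step (x, .inr i) d := by
  rintro ⟨w, a, h, -⟩
  cases (Prod.mk.inj h).2

/-- The walk is deterministic and stops at leaves. -/
theorem walk_unique {d : (H.W ⊕ Fin k) × (H.W ⊕ Fin k)} {x y : H.W ⊕ Fin k} {i l : Fin k}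
    (h : Relation.ReflTransGen H.Step d (x, .inr i))
    (h' : Relation.ReflTransGen H.Step d (y, .inr l)) : i = l := by
  induction h using Relation.ReflTransGen.head_induction_on with
  | refl =>
    rcases h'.cases_head with h | ⟨c, hc, -⟩
    · exact Sum.inr.inj (Prod.mk.inj h).2
    · exact (not_step_leaf hc).elim
  | head hs _ ih =>
    rcases h'.cases_head with rfl | ⟨c, hc, h''⟩
    · exact (not_step_leaf hs).elim
    · rw [hs.unique hc] at ih
      exact ih h''

/-- The only use of the plane embedding: it ties the walk around the tree to the cyclic order on C.
-/
theorem walk_next {i l : Fin k} {x : H.W ⊕ Fin k}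
    (h : Relation.ReflTransGen H.Step (.inr i, .inl (H.att i)) (x, .inr l)) : l = i + 1 := by
  obtain ⟨y, hy⟩ := H.contour i
  exact walk_unique h hy

theorem src_mate (e : H.treePole.Ends) : H.src (H.treePole.mate e) = H.tgt e :=
  (H.exists_end (H.adj_src_tgt e).symm).choose_spec.1

theorem tgt_mate (e : H.treePole.Ends) : H.tgt (H.treePole.mate e) = H.src e :=
  (H.exists_end (H.adj_src_tgt e).symm).choose_spec.2

theorem mate_eq {e e' : H.treePole.Ends} (h : H.src e' = H.tgt e) (h' : H.tgt e' = H.src e) :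
    H.treePole.mate e = e' :=
  H.end_ext ((src_mate e).trans h.symm) ((tgt_mate e).trans h'.symm)

theorem adj_nb (w : H.W) (a : Fin 3) : H.tree.Adj (H.nb w a) (.inl w) :=
  ((H.adj_inner w _).2 ⟨a, rfl⟩).symm

theorem dist_child {r : H.W ⊕ Fin k} {w : H.W} {a b : Fin 3}
    (h : H.tree.dist r (.inl w) = H.tree.dist r (H.nb w a) + 1) (hb : b ≠ a) :
    H.tree.dist r (H.nb w b) = H.tree.dist r (.inl w) + 1 := by
  rcases H.isTree.dist_eq_dist_add_one_of_adj r (adj_nb w b) with h' | h'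
  · exact h'
  · exact absurd (H.nb_injective w
      (H.isTree.eq_of_dist_eq_add_one (adj_nb w b) (adj_nb w a) h' h)) hb

/-- The walk around the tree which follows the end `e` meets the leaves `v_i, …, v_l`, all of them
different from `v_j`, before it returns along `e`, and these leaves are in the relation `Q`. -/
def Spans {A : Type*} (τ : H.treePole.Ends → A) (Q : A → Fin k → Fin k → Prop) (j : Fin k)
    (e : H.treePole.Ends) : Prop :=
  ∃ i l, i ≠ j ∧ (∃ x, Relation.ReflTransGen H.Step (H.src e, H.tgt e) (x, .inr i)) ∧
    Relation.ReflTransGen H.Step (.inr l, .inl (H.att l)) (H.tgt e, H.src e) ∧ Q (τ e) i l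

/-! ### Induction along the tree rooted at v_j -/

section Induction

variable {A : Type*} {τ : H.treePole.Ends → A} {Q Q' : A → Fin k → Fin k → Prop} {j : Fin k}

/-- On returning to w from the first subtree, the walk steps straight into the second, so the second
interval starts at l + 1. That leaf is not v_j, so the decollineator between the intervals is
present. -/
theorem spans_inner (hτ : ∀ e, τ (H.treePole.mate e) = τ e)
    (hcomp : ∀ w a i l m, l + 1 ≠ j → Q (τ (.inl (w, a + 1))) i l →
      Q (τ (.inl (w, a + 2))) (l + 1) m → Q' (τ (.inl (w, a))) i m)
    {w : H.W} {a : Fin 3} {e : H.treePole.Ends} (hsrc : H.src e = H.nb w a)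
    (htgt : H.tgt e = .inl w) (h₁ : Spans τ Q j (.inl (w, a + 1)))
    (h₂ : Spans τ Q j (.inl (w, a + 2))) : Spans τ Q' j e := by
  obtain ⟨i, l, hi, ⟨x, hix⟩, hl, hQ⟩ := h₁
  obtain ⟨i', m, hi', ⟨x', hix'⟩, hm, hQ'⟩ := h₂
  have h₃ : i' = l + 1 := by
    have h : a + 1 + 1 = a + 2 := add_assoc a 1 1
    exact walk_next ((hl.tail ⟨w, a + 1, rfl, by rw [h]; rfl⟩).trans hix')
  subst h₃
  refine ⟨i, m, hi, ⟨x, hix.head ⟨w, a, by rw [hsrc, htgt], rfl⟩⟩, ?_, ?_⟩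
  -- Modulo 3, a + 2 + 1 = a: after the second subtree the walk leaves w along `e`.
  · refine hm.tail ⟨w, a + 2, rfl, ?_⟩
    rw [hsrc, htgt, add_assoc]
    congr 2
    fin_cases a <;> rfl
  · have h := hcomp w a i l m hi' hQ hQ'
    rwa [← hτ, mate_eq (e := .inl (w, a)) (e' := e) hsrc htgt] at h

theorem spans_of_dist (hτ : ∀ e, τ (H.treePole.mate e) = τ e)
    (hleaf : ∀ i, Q (τ (.inr i)) i i) (hle : ∀ x i l, Q' x i l → Q x i l)
    (hcomp : ∀ w a i l m, l + 1 ≠ j → Q (τ (.inl (w, a + 1))) i l →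
      Q (τ (.inl (w, a + 2))) (l + 1) m → Q' (τ (.inl (w, a))) i m)
    (e : H.treePole.Ends)
    (he : H.tree.dist (.inr j) (H.tgt e) = H.tree.dist (.inr j) (H.src e) + 1) :
    Spans τ Q j e := by
  have := H.fin
  obtain ⟨N, hN⟩ := (Set.finite_range (H.tree.dist (.inr j))).bddAbove
  have hN : ∀ x, H.tree.dist (.inr j) x ≤ N := fun x => hN ⟨x, rfl⟩
  -- Distances from the root are bounded in a finite tree; `n` bounds the remaining depth below `e`
  -- and drives the induction.
  obtain ⟨n, hn⟩ : ∃ n, N < H.tree.dist (.inr j) (H.tgt e) + n := ⟨N + 1, by omega⟩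
  induction n generalizing e with
  | zero => exact absurd (hN (H.tgt e)) (by omega)
  | succ n ih =>
    rcases htgt : H.tgt e with w | i
    · obtain ⟨a, ha⟩ := (H.adj_inner w (H.src e)).1 (htgt ▸ (H.adj_src_tgt e).symm)
      rw [htgt] at he hn
      rw [← ha] at he
      have child : ∀ b, b ≠ a → Spans τ Q j (.inl (w, b)) := fun b hb => by
        have h := dist_child he hb
        refine ih _ h ?_
        change N < H.tree.dist (.inr j) (H.nb w b) + n
        omega
      obtain ⟨i, l, hi, hx, hl, hQ⟩ := spans_inner hτ hcomp ha.symm htgt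
        (child (a + 1) (by fin_cases a <;> decide)) (child (a + 2) (by fin_cases a <;> decide))
      exact ⟨i, l, hi, hx, hl, hle _ _ _ hQ⟩
    · have hsrc : H.src e = .inl (H.att i) :=
        (H.adj_leaf i _).1 (htgt ▸ (H.adj_src_tgt e).symm)
      refine ⟨i, i, ?_, ⟨H.src e, by rw [htgt]⟩, by rw [htgt, hsrc], ?_⟩
      · rintro rfl
        rw [htgt, SimpleGraph.dist_self] at he
        omega
      · rw [← hτ, mate_eq (e' := .inr i) htgt.symm hsrc.symm]
        exact hleaf i

/-- Induction along the inscribed tree: a relation between first and last leaf of an interval, which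
holds for single leaves and is inherited by the union of the intervals of two sibling subtrees,
holds for the interval of all leaves except one. -/
theorem contour_induction (hτ : ∀ e, τ (H.treePole.mate e) = τ e)
    (hleaf : ∀ i, Q (τ (.inr i)) i i) (hle : ∀ x i l, Q' x i l → Q x i l)
    (hcomp : ∀ w a i l m, l + 1 ≠ j → Q (τ (.inl (w, a + 1))) i l →
      Q (τ (.inl (w, a + 2))) (l + 1) m → Q' (τ (.inl (w, a))) i m) :
    j + 1 ≠ j ∧ Q' (τ (.inr j)) (j + 1) (j - 1) := by
  have hadj := H.adj_src_tgt (.inr j)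
  obtain ⟨a, ha⟩ := (H.adj_inner (H.att j) (.inr j)).1 hadj.symm
  have hd : H.tree.dist (.inr j) (.inl (H.att j)) =
      H.tree.dist (.inr j) (H.nb (H.att j) a) + 1 := by
    rw [ha, SimpleGraph.dist_self, SimpleGraph.dist_eq_one_iff_adj]
    exact hadj
  have child : ∀ b, b ≠ a → Spans τ Q j (.inl (H.att j, b)) := fun b hb =>
    spans_of_dist hτ hleaf hle hcomp _ (dist_child hd hb)
  -- The root edge leads to a trivalent vertex, so the last step is a composition and yields the
  -- stronger `Q'`.
  obtain ⟨i, l, hi, ⟨x, hx⟩, hl, hQ⟩ := spans_inner (e := .inr j) hτ hcomp ha.symm rfl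
    (child (a + 1) (by fin_cases a <;> decide)) (child (a + 2) (by fin_cases a <;> decide))
  obtain rfl : i = j + 1 := walk_next hx
  obtain rfl : l = j - 1 := eq_sub_of_add_eq (walk_next hl).symm
  exact ⟨hi, hQ⟩

end Induction

end CubicHalinGraph

/-! ### Transitions through Halin poles -/

theorem halinPole_shape {T : Tetrahedron} {k : ℕ} [NeZero k] {H : CubicHalinGraph k}
    {D : Fin k → Multipole Label22} (hD : ∀ i, IsDecollineator T (D i))
    {B : Fin k → Multipole Label221} (hB : ∀ i, IsBipartitePole (B i)) {j : Fin k}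
    {φ : (halinPole H D B j).Ends → Vec} (hφ : (halinPole H D B j).IsTFlow T φ) :
    let σ := T.shape (φ (.inr (.inp 0))) (φ (.inr (.inp 1)))
    let ρ := T.shape (φ (.inr (.out 0))) (φ (.inr (.out 1)))
    (σ = .ls ∧ ρ = .ls) ∨ (σ = .hl ∧ ρ = .hl) := by
  obtain ⟨τ, β, hτ, hβ, hres, hδ, hinp, hout⟩ := exists_flows_of_halinPole hφ
  let inSum : Fin k → Vec := fun i => β i (.inr (.inp 0)) + β i (.inr (.inp 1))
  let outSum : Fin k → Vec := fun i => β i (.inr (.out 0)) + β i (.inr (.out 1))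
  let inShape : Fin k → Shape := fun i => T.shape (β i (.inr (.inp 0))) (β i (.inr (.inp 1)))
  let outShape : Fin k → Shape := fun i => T.shape (β i (.inr (.out 0))) (β i (.inr (.out 1)))
  have hin : ∀ i, (inShape i).weight = T.wt (inSum i) := fun i =>
    T.weight_shape ((hβ i).point _) ((hβ i).point _)
  have hout' : ∀ i, (outShape i).weight = T.wt (outSum i) := fun i =>
    T.weight_shape ((hβ i).point _) ((hβ i).point _)
  have hdec : ∀ i, i + 1 ≠ j → Decollinear (outShape i) (inShape (i + 1)) ∧
      outSum i = inSum (i + 1) := by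
    intro i hi
    obtain ⟨δ, hδ, h, h'⟩ := hδ _ hi
    rw [add_sub_cancel_right] at h
    have h₁ := (hD _).decollinear hδ
    have h₂ := hδ.sum_inp_eq
    rw [h, h, h', h'] at h₁ h₂
    exact ⟨h₁, h₂⟩
  have hpos : ∀ e, 0 < T.wt (τ e) := fun e => by
    rcases T.mem_points.1 (hτ.point e) with h | h <;> omega
  have hleaf : ∀ i, Linked (T.wt (τ (.inr i))) (inShape i) (outShape i) ∧
      inSum i + outSum i = τ (.inr i) := fun i => by
    rw [hres]
    exact ⟨(hB i).linked (hβ i), (hB i).sum_points (hβ i)⟩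
  have hcyc : ∀ (A : Type) [AddCommMonoid A] (f : Fin 3 → A) (a : Fin 3),
      f (a + 1) + f (a + 2) + f a = ∑ b, f b := by
    intro A _ f a
    rw [Fin.sum_univ_three]
    fin_cases a
    · exact (add_rotate _ _ _).symm
    · exact (add_rotate _ _ _)
    · rfl
  -- The vector identity is carried along with the shapes, since it supplies the triangle condition
  -- for the next composition.
  obtain ⟨hne, hrest, hsum⟩ := H.contour_induction (τ := τ) (j := j)
    (Q := fun x i l => Linked (T.wt x) (inShape i) (outShape l) ∧ inSum i + outSum l = x)
    (Q' := fun x i l => StronglyLinked (T.wt x) (inShape i) (outShape l) ∧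
      inSum i + outSum l = x)
    hτ.edge hleaf (fun x i l h => ⟨h.1.linked, h.2⟩) (by
      intro w a i l m hl ⟨h₁, hs₁⟩ ⟨h₂, hs₂⟩
      obtain ⟨hd, hds⟩ := hdec l hl
      have hw := (hcyc _ (fun b => T.wt (τ (.inl (w, b)))) a).trans (T.sum_wt_line (hτ.line w))
      have hv := (hcyc _ (fun b => τ (.inl (w, b))) a).trans (T.sum_line (hτ.line w))
      have hs : inSum i + outSum m = τ (.inl (w, a)) := by
        rw [← CharTwo.add_eq_zero.1 hv, ← hs₁, ← hs₂, hds, vec_add_add_cancel]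
      refine ⟨h₁.comp hd h₂ (hpos _) (hpos _) (hpos _) hw ?_, hs⟩
      rw [hin, hout', ← hs]
      exact T.wt_triangle _ _)
  obtain ⟨hl, hs⟩ := hleaf j
  obtain ⟨hd, hds⟩ := hdec j hne
  -- The two sums over the connectors of D_{j+1} coincide, and B_j and the remaining chain both add
  -- up to the value on the root edge.
  have key : inSum j = outSum (j - 1) := by
    have h := hs.trans hsum.symm
    rw [hds, add_comm] at h
    exact add_left_cancel h
  have hfin := Linked.close (T.mem_points.1 (hτ.point (.inr j))) hl hd hrest
    (by rw [hin, hout', key])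
  simpa only [hinp, hout] using hfin

theorem theorem8p4 (T : Tetrahedron) {k : ℕ} [NeZero k] (H : CubicHalinGraph k)
    (D : Fin k → Multipole Label22) (hD : ∀ i, IsDecollineator T (D i))
    (B : Fin k → Multipole Label221) (hB : ∀ i, IsBipartitePole (B i)) (j : Fin k) :
    (∀ p q : Sym2 Vec, HasTransition T (halinPole H D B j) p q →
      (p ∈ T.pairs .ls ∧ q ∈ T.pairs .ls) ∨ (p ∈ T.pairs .hl ∧ q ∈ T.pairs .hl)) ∧
    IsCollineator T (halinPole H D B j) := by
  constructor
  · rintro p q ⟨φ, hφ, rfl, rfl⟩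
    rcases halinPole_shape hD hB hφ with ⟨h, h'⟩ | ⟨h, h'⟩
    · exact .inl ⟨T.mem_pairs_of_shape_eq_ls (hφ.point _) (hφ.point _) h,
        T.mem_pairs_of_shape_eq_ls (hφ.point _) (hφ.point _) h'⟩
    · exact .inr ⟨T.mem_pairs_of_shape_eq_hl (hφ.point _) (hφ.point _) h,
        T.mem_pairs_of_shape_eq_hl (hφ.point _) (hφ.point _) h'⟩
  · rintro ⟨σ, ρ⟩ ⟨p, hp, q, hq, φ, hφ, rfl, rfl⟩
    have h := halinPole_shape hD hB hφ
    simp only [T.shape_of_mem_pairs hp, T.shape_of_mem_pairs hq] at h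
    rcases h with ⟨rfl, rfl⟩ | ⟨rfl, rfl⟩ <;> simp
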